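/- **Setting.** All Hilbert spaces are complex, scalar products are linear in the first variable, and $\otimes$ is the Hilbert space tensor product. A positive definite kernel $K:\Lambda\times\Lambda\to\mathbb{C}$ has reproducing kernel space $\mathfrak{H}(K)$ and kernel functions $k_\lambda(\mu)=K(\mu,\lambda)$. It is a *Pick kernel* if $K(\mu,\lambda)\neq 0$ for all $\mu,\lambda$ and, for every $\lambda_0\in\Lambda$, the function $1-\frac{K(\mu,\lambda_0)K(\lambda_0,\lambda)}{K(\mu,\lambda)K(\lambda_0,\lambda_0)}$ is a positive definite kernel. Fix $\lambda_0\in\Lambda$ and put $\delta=k_{\lambda_0}/\|k_{\lambda_0}\|$. Then there are a Hilbert space $\mathcal{B}$ and a function $\beta:\Lambda\to\mathcal{B}$, whose values span a dense subspace, with $$K(\mu,\lambda)=\frac{\delta(\mu)\overline{\delta(\lambda)}}{1-\langle\beta(\lambda),\beta(\mu)\rangle};$$ they are unique up to a unitary, and we fix any such pair. Let $K'(\mu,\lambda)=\frac{K(\mu,\lambda)}{\delta(\mu)\overline{\delta(\lambda)}}$; then $\Omega f=f/\delta$ is a unitary from $\mathfrak{H}(K)$ onto $\mathfrak{H}(K')$.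 For a Hilbert space $\mathcal{G}$ we also write $\Omega$ for $\Omega\otimes I_{\mathcal{G}}:\mathfrak{H}(K)\otimes\mathcal{G}\to\mathfrak{H}(K')\otimes\mathcal{G}$. Let $\boldsymbol{B}:\mathcal{B}\otimes\mathfrak{H}(K')\to\mathfrak{H}(K')$ be the contraction given by $\boldsymbol{B}(\xi\otimes f)(\lambda)=\langle\xi,\beta(\lambda)\rangle f(\lambda)$. A Hilbert space $\mathcal{N}$ is *contractively included* in a Hilbert space $\mathcal{H}$ if it is a vector subspace of $\mathcal{H}$ and $\|x\|_{\mathcal{H}}\le\|x\|_{\mathcal{N}}$ on $\mathcal{N}$. The *complementary subspace* $\mathcal{M}^\sharp$ of a contractively included $\mathcal{M}$ is the unique contractively included Hilbert space such that $\|x+y\|^2_{\mathcal H}\le\|x\|_{\mathcal{M}}^2+\|y\|_{\mathcal{M}^\sharp}^2$ for all $x\in\mathcal{M}$, $y\in\mathcal{M}^\sharp$, and every $z\in\mathcal{H}$ has a unique decomposition $z=x+y$ with $x\in\mathcal{M}$, $y\in\mathcal{M}^\sharp$ and $\|z\|^2_{\mathcal H}=\|x\|_{\mathcal{M}}^2+\|y\|_{\mathcal{M}^\sharp}^2$.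 A function $G:\Lambda\to\mathcal{L}(\mathcal{G}',\mathcal{G})$ is a *contractive multiplier* of $\mathfrak{H}(K)$ if there is a contraction $\mathfrak{m}_G:\mathfrak{H}(K)\otimes\mathcal{G}'\to\mathfrak{H}(K)\otimes\mathcal{G}$ with $\mathfrak{m}_G^*(k_\lambda\otimes y)=k_\lambda\otimes G(\lambda)^*y$ for all $\lambda\in\Lambda$, $y\in\mathcal{G}$; then $\mathcal{M}_G$ denotes the range of $\mathfrak{m}_G$ with the norm $\|x\|=\inf\{\|y\|:\mathfrak{m}_Gy=x\}$. **Theorem.** Let $K$ be a Pick kernel on $\Lambda$, let $\mathcal{G}$ be a Hilbert space, and let $\mathcal{N}$ be contractively included in $\mathfrak{H}(K)\otimes\mathcal{G}$. Let $\Omega\mathcal{N}\subset\mathfrak{H}(K')\otimes\mathcal{G}$ carry the norm $\|\Omega\xi\|_{\Omega\mathcal{N}}=\|\xi\|_{\mathcal{N}}$. The following are equivalent: (i) There are a Hilbert space $\mathcal{G}'$ and a contractive multiplier $G:\Lambda\to\mathcal{L}(\mathcal{G}',\mathcal{G})$ of $\mathfrak{H}(K)$ such that $\mathcal{N}=\mathcal{M}_G^\sharp$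 (with equality of norms). (ii) There is a linear contraction $\tilde{\boldsymbol{B}}:\Omega\mathcal{N}\to\mathcal{B}\otimes\Omega\mathcal{N}$ such that for all $\xi\in\mathcal{N}$ $$\Omega\xi=(\boldsymbol{B}\otimes I_{\mathcal{G}})\tilde{\boldsymbol{B}}\Omega\xi+(\pi'\otimes I_{\mathcal{G}})\Omega\xi,$$ $$\|\tilde{\boldsymbol{B}}\Omega\xi\|^2_{\mathcal{B}\otimes\Omega\mathcal{N}}\le\|\Omega\xi\|^2_{\Omega\mathcal{N}}-\|(\pi'\otimes I_{\mathcal{G}})\Omega\xi\|^2_{\mathfrak{H}(K')\otimes\mathcal{G}},$$ where $\pi'$ is the orthogonal projection of $\mathfrak{H}(K')$ onto the constant functions. In the first relation $\mathcal{B}\otimes\Omega\mathcal{N}$ is mapped into $\mathcal{B}\otimes\mathfrak{H}(K')\otimes\mathcal{G}$ by $I_{\mathcal{B}}$ tensored with the inclusion. -/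

import Mathlib

open scoped TensorProduct ComplexOrder ComplexConjugate InnerProductSpace

universe u

noncomputable section

/-! ### Hilbert space tensor products -/

section HilbertTensor

variable (E F : Type*) [NormedAddCommGroup E] [InnerProductSpace ℂ E]
  [NormedAddCommGroup F] [InnerProductSpace ℂ F]

/-- The Hilbert space tensor product of `E` and `F`: the completion of the algebraic tensor
product for the inner product with `⟪x ⊗ y, x' ⊗ y'⟫ = ⟪x, x'⟫ * ⟪y, y'⟫`. -/
def HTensor : Type _ := UniformSpace.Completion (E ⊗[ℂ] F)

instance : NormedAddCommGroup (HTensor E F) :=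
  inferInstanceAs (NormedAddCommGroup (UniformSpace.Completion (E ⊗[ℂ] F)))

instance : InnerProductSpace ℂ (HTensor E F) :=
  inferInstanceAs (InnerProductSpace ℂ (UniformSpace.Completion (E ⊗[ℂ] F)))

instance : CompleteSpace (HTensor E F) :=
  inferInstanceAs (CompleteSpace (UniformSpace.Completion (E ⊗[ℂ] F)))

infixl:100 " ⊗ₕ " => HTensor

namespace HTensor

/-- The inclusion of the algebraic tensor product. -/
def incl : E ⊗[ℂ] F →ₗᵢ[ℂ] E ⊗ₕ F := UniformSpace.Completion.toComplₗᵢ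

theorem denseRange_incl : DenseRange (incl E F) := UniformSpace.Completion.denseRange_coe

variable {E F}

/-- Simple tensors. -/
def tmul (x : E) (y : F) : E ⊗ₕ F := incl E F (x ⊗ₜ[ℂ] y)

theorem inner_tmul (x x' : E) (y y' : F) :
    ⟪tmul x y, tmul x' y'⟫_ℂ = ⟪x, x'⟫_ℂ * ⟪y, y'⟫_ℂ := by
  simp [tmul]

variable {E' F' : Type*} [NormedAddCommGroup E'] [InnerProductSpace ℂ E']
  [NormedAddCommGroup F'] [InnerProductSpace ℂ F']

/-- The tensor product `S ⊗ T` of two bounded operators. -/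
def map (S : E →L[ℂ] E') (T : F →L[ℂ] F') : E ⊗ₕ F →L[ℂ] E' ⊗ₕ F' :=
  ((incl E' F').toContinuousLinearMap ∘L TensorProduct.mapL S T).extend
    (incl E F).toContinuousLinearMap

theorem map_tmul (S : E →L[ℂ] E') (T : F →L[ℂ] F') (x : E) (y : F) :
    map S T (tmul x y) = tmul (S x) (T y) :=
  ContinuousLinearMap.extend_eq _ (denseRange_incl E F)
    (incl E F).isometry.isUniformInducing (x ⊗ₜ[ℂ] y)

/-- The unitary `U ⊗ I` for a unitary `U`. -/
def congrLeft (U : E ≃ₗᵢ[ℂ] E') (F : Type*) [NormedAddCommGroup F] [InnerProductSpace ℂ F] :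
    E ⊗ₕ F ≃ₗᵢ[ℂ] E' ⊗ₕ F :=
  (U.rTensor F).toLinearEquiv.extendOfIsometry
    (incl E F).toLinearMap (incl E' F).toLinearMap (denseRange_incl E F) (denseRange_incl E' F)
    (fun x => by
      simp only [LinearIsometry.coe_toLinearMap, LinearIsometryEquiv.coe_toLinearEquiv,
        LinearIsometry.norm_map, LinearIsometryEquiv.norm_map])

theorem congrLeft_tmul (U : E ≃ₗᵢ[ℂ] E') (x : E) (y : F) :
    congrLeft U F (tmul x y) = tmul (U x) y :=
  LinearEquiv.extendOfIsometry_eq _ _ _ (denseRange_incl E F) (denseRange_incl E' F)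
    (fun x => by
      simp only [LinearIsometry.coe_toLinearMap, LinearIsometryEquiv.coe_toLinearEquiv,
        LinearIsometry.norm_map, LinearIsometryEquiv.norm_map]) (x ⊗ₜ[ℂ] y)

theorem denseRange_incl_of_denseRange {E₁ F₁ : Type*} [NormedAddCommGroup E₁]
    [InnerProductSpace ℂ E₁] [NormedAddCommGroup F₁] [InnerProductSpace ℂ F₁]
    (S : E₁ →ₗᵢ[ℂ] E) (hS : DenseRange S) (T : F₁ →ₗᵢ[ℂ] F) (hT : DenseRange T) :
    DenseRange ((incl E F).comp (TensorProduct.mapIsometry S T)) := by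
  refine (denseRange_incl E F).comp ?_ (incl E F).continuous
  have key : ∀ z : E ⊗[ℂ] F,
      z ∈ (LinearMap.range (TensorProduct.mapIsometry S T).toLinearMap).topologicalClosure := by
    intro z
    induction z using TensorProduct.induction_on with
    | zero => exact zero_mem _
    | add a b ha hb => exact add_mem ha hb
    | tmul x y =>
      have hd : DenseRange (Prod.map S T) := hS.prodMap hT
      refine hd.induction_on (p := fun w : E × F => w.1 ⊗ₜ[ℂ] w.2 ∈
        (LinearMap.range (TensorProduct.mapIsometry S T).toLinearMap).topologicalClosure)
        (x, y) ?_ ?_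
      · exact (Submodule.isClosed_topologicalClosure _).preimage
          (TensorProduct.continuous_tmul (𝕜 := ℂ) (E := E) (F := F))
      · rintro ⟨a, b⟩
        exact Submodule.le_topologicalClosure _ ⟨a ⊗ₜ b, by simp⟩
  intro z
  exact key z

/-- The canonical unitary identifying `E ⊗ (F ⊗ G)` with `(E ⊗ F) ⊗ G`. -/
def assoc (E F G : Type*) [NormedAddCommGroup E] [InnerProductSpace ℂ E]
    [NormedAddCommGroup F] [InnerProductSpace ℂ F] [NormedAddCommGroup G]
    [InnerProductSpace ℂ G] : E ⊗ₕ (F ⊗ₕ G) ≃ₗᵢ[ℂ] (E ⊗ₕ F) ⊗ₕ G :=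
  (TensorProduct.assocIsometry ℂ E F G).symm.toLinearEquiv.extendOfIsometry
    ((incl E (F ⊗ₕ G)).comp
      (TensorProduct.mapIsometry LinearIsometry.id (incl F G))).toLinearMap
    ((incl (E ⊗ₕ F) G).comp
      (TensorProduct.mapIsometry (incl E F) LinearIsometry.id)).toLinearMap
    (denseRange_incl_of_denseRange _ denseRange_id _ (denseRange_incl F G))
    (denseRange_incl_of_denseRange _ (denseRange_incl E F) _ denseRange_id)
    (fun x => by
      simp only [LinearIsometry.coe_toLinearMap, LinearIsometryEquiv.coe_toLinearEquiv,
        LinearIsometry.norm_map, LinearIsometryEquiv.norm_map])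

theorem assoc_tmul {G : Type*} [NormedAddCommGroup G] [InnerProductSpace ℂ G]
    (x : E) (y : F) (z : G) :
    assoc E F G (tmul x (tmul y z)) = tmul (tmul x y) z :=
  LinearEquiv.extendOfIsometry_eq (TensorProduct.assocIsometry ℂ E F G).symm.toLinearEquiv
    ((incl E (F ⊗ₕ G)).comp
      (TensorProduct.mapIsometry LinearIsometry.id (incl F G))).toLinearMap
    ((incl (E ⊗ₕ F) G).comp
      (TensorProduct.mapIsometry (incl E F) LinearIsometry.id)).toLinearMap
    (denseRange_incl_of_denseRange _ denseRange_id _ (denseRange_incl F G))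
    (denseRange_incl_of_denseRange _ (denseRange_incl E F) _ denseRange_id)
    (fun x => by
      simp only [LinearIsometry.coe_toLinearMap, LinearIsometryEquiv.coe_toLinearEquiv,
        LinearIsometry.norm_map, LinearIsometryEquiv.norm_map]) (x ⊗ₜ[ℂ] (y ⊗ₜ[ℂ] z))

end HTensor

end HilbertTensor

/-! ### Contractively included subspaces -/

/-- A contractively included subspace of the Hilbert space `H`: a Hilbert space `Space` with an
injective linear contraction `incl` into `H`, by which its elements are regarded as elements
of `H`. -/
structure ContractiveSubspace (H : Type u) [NormedAddCommGroup H] [InnerProductSpace ℂ H] where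
  Space : Type u
  [normed : NormedAddCommGroup Space]
  [innerProd : InnerProductSpace ℂ Space]
  [complete : CompleteSpace Space]
  incl : Space →L[ℂ] H
  injective : Function.Injective incl
  norm_incl_le : ∀ x, ‖incl x‖ ≤ ‖x‖

namespace ContractiveSubspace

attribute [instance] normed innerProd complete

variable {H H' : Type u} [NormedAddCommGroup H] [InnerProductSpace ℂ H]
  [NormedAddCommGroup H'] [InnerProductSpace ℂ H']

/-- The image of a contractively included subspace under a unitary of the ambient spaces, with
the norm `‖U x‖ = ‖x‖`. -/
def image (N : ContractiveSubspace H) (U : H ≃ₗᵢ[ℂ] H') : ContractiveSubspace H' where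
  Space := N.Space
  incl := (U : H →L[ℂ] H') ∘L N.incl
  injective := U.injective.comp N.injective
  norm_incl_le x := by simpa using N.norm_incl_le x

/-- The map `x ↦ U x` from `N` onto its image under `U`. -/
def toImage (N : ContractiveSubspace H) (U : H ≃ₗᵢ[ℂ] H') :
    N.Space ≃ₗᵢ[ℂ] (N.image U).Space :=
  LinearIsometryEquiv.refl ℂ N.Space

theorem incl_toImage (N : ContractiveSubspace H) (U : H ≃ₗᵢ[ℂ] H') (x : N.Space) :
    (N.image U).incl (N.toImage U x) = U (N.incl x) := rfl

/-- The range space of a contraction `C : E → H`: its elements are those of the range of `C`.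
It is realised on `(ker C)ᗮ`, which `C` maps unitarily onto the range; see `norm_range`. -/
def range {E : Type u} [NormedAddCommGroup E] [InnerProductSpace ℂ E] [CompleteSpace E]
    (C : E →L[ℂ] H) (hC : ‖C‖ ≤ 1) : ContractiveSubspace H where
  Space := ↥((LinearMap.ker C.toLinearMap)ᗮ)
  normed := inferInstance
  innerProd := inferInstance
  complete := inferInstance
  incl := C ∘L (LinearMap.ker C.toLinearMap)ᗮ.subtypeL
  injective := by
    refine (injective_iff_map_eq_zero _).2 fun x hx => ?_
    have h1 : (x : E) ∈ LinearMap.ker C.toLinearMap := hx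
    exact Subtype.ext (inner_self_eq_zero (𝕜 := ℂ).1
      (Submodule.inner_right_of_mem_orthogonal h1 x.2))
  norm_incl_le x := C.le_of_opNorm_le hC (x : E) |>.trans_eq (one_mul _)

/-- The elements of the range space are those of the range of `C`. -/
theorem range_range {E : Type u} [NormedAddCommGroup E] [InnerProductSpace ℂ E]
    [CompleteSpace E] (C : E →L[ℂ] H) (hC : ‖C‖ ≤ 1) :
    Set.range (range C hC).incl = Set.range C := by
  apply Set.Subset.antisymm
  · rintro _ ⟨x, rfl⟩
    let x' : ↥((LinearMap.ker C.toLinearMap)ᗮ) := x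
    exact ⟨(x' : E), rfl⟩
  · rintro _ ⟨y, rfl⟩
    have hcl : IsClosed (LinearMap.ker C.toLinearMap : Set E) := C.isClosed_ker
    have : CompleteSpace (LinearMap.ker C.toLinearMap) := hcl.completeSpace_coe
    refine ⟨⟨y - (LinearMap.ker C.toLinearMap).starProjection y,
      Submodule.sub_starProjection_mem_orthogonal y⟩, ?_⟩
    have h0 : C ((LinearMap.ker C.toLinearMap).starProjection y) = 0 :=
      LinearMap.mem_ker.1 (Submodule.starProjection_apply_mem _ y)
    change C (y - (LinearMap.ker C.toLinearMap).starProjection y) = C y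
    rw [map_sub, h0, sub_zero]

/-- The norm of the range space is `‖x‖ = inf {‖y‖ : C y = x}`. -/
theorem norm_range {E : Type u} [NormedAddCommGroup E] [InnerProductSpace ℂ E]
    [CompleteSpace E] (C : E →L[ℂ] H) (hC : ‖C‖ ≤ 1) (x : (range C hC).Space) :
    IsLeast {r : ℝ | ∃ y : E, C y = (range C hC).incl x ∧ ‖y‖ = r} ‖x‖ := by
  let x' : ↥((LinearMap.ker C.toLinearMap)ᗮ) := x
  refine ⟨⟨(x' : E), rfl, rfl⟩, ?_⟩
  rintro r ⟨y, hy, rfl⟩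
  have hy' : C y = C (x' : E) := hy
  have hk : y - (x' : E) ∈ LinearMap.ker C.toLinearMap := by
    rw [LinearMap.mem_ker]; simp [hy']
  have ho : ⟪y - (x' : E), (x' : E)⟫_ℂ = 0 :=
    Submodule.inner_right_of_mem_orthogonal hk x'.2
  have hp := norm_add_sq_eq_norm_sq_add_norm_sq_of_inner_eq_zero _ _ ho
  rw [sub_add_cancel] at hp
  change ‖(x' : E)‖ ≤ ‖y‖
  nlinarith [norm_nonneg y, norm_nonneg (x' : E), mul_self_nonneg ‖y - (x' : E)‖]

/-- `N` is the complementary subspace of `M`. -/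
structure IsComplement (M N : ContractiveSubspace H) : Prop where
  norm_add_sq_le : ∀ (x : M.Space) (y : N.Space),
    ‖M.incl x + N.incl y‖ ^ 2 ≤ ‖x‖ ^ 2 + ‖y‖ ^ 2
  existsUnique_decomposition : ∀ z : H, ∃! p : M.Space × N.Space,
    z = M.incl p.1 + N.incl p.2 ∧ ‖z‖ ^ 2 = ‖p.1‖ ^ 2 + ‖p.2‖ ^ 2

end ContractiveSubspace

/-! ### Operators defined on total families -/

section Gram

variable {ι E F : Type*} [NormedAddCommGroup E] [InnerProductSpace ℂ E]
  [NormedAddCommGroup F] [InnerProductSpace ℂ F]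

theorem sum_gram (a : ι → E) (c : ι →₀ ℂ) :
    (c.sum fun i x => c.sum fun j y => star x * ⟪a i, a j⟫_ℂ * y) =
      ((‖Finsupp.linearCombination ℂ a c‖ ^ 2 : ℝ) : ℂ) := by
  have h := inner_self_eq_norm_sq_to_K (𝕜 := ℂ) (Finsupp.linearCombination ℂ a c)
  push_cast
  rw [← Complex.coe_algebraMap] at *
  rw [← RCLike.algebraMap_eq_ofReal] at h
  refine Eq.trans ?_ h
  rw [Finsupp.linearCombination_apply, Finsupp.sum_inner]
  simp only [Finsupp.inner_sum, inner_smul_left, inner_smul_right]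
  refine Finsupp.sum_congr fun i _ => Finsupp.sum_congr fun j _ => ?_
  simp only [RCLike.star_def]
  ring

theorem posSemidef_of_gram (a : ι → E) :
    (Matrix.of fun i j => ⟪a i, a j⟫_ℂ).PosSemidef := by
  refine ⟨?_, fun c => ?_⟩
  · ext i j
    simp [Matrix.conjTranspose_apply]
  · simp only [Matrix.of_apply]
    rw [sum_gram]
    exact Complex.zero_le_real.2 (sq_nonneg _)

theorem norm_le_of_posSemidef (a : ι → E) (b : ι → F)
    (h : (Matrix.of fun i j => ⟪a i, a j⟫_ℂ - ⟪b i, b j⟫_ℂ).PosSemidef) (c : ι →₀ ℂ) :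
    ‖Finsupp.linearCombination ℂ b c‖ ≤ ‖Finsupp.linearCombination ℂ a c‖ := by
  have h1 := h.2 c
  simp only [Matrix.of_apply, mul_sub, sub_mul, Finsupp.sum_sub] at h1
  rw [sum_gram, sum_gram, ← Complex.ofReal_sub] at h1
  have h2 : (0 : ℝ) ≤ ‖Finsupp.linearCombination ℂ a c‖ ^ 2 -
      ‖Finsupp.linearCombination ℂ b c‖ ^ 2 := by exact_mod_cast h1
  exact (sq_le_sq₀ (norm_nonneg _) (norm_nonneg _)).1 (by linarith)

variable [CompleteSpace F]

theorem exists_contraction (a : ι → E) (b : ι → F)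
    (ha : (Submodule.span ℂ (Set.range a)).topologicalClosure = ⊤)
    (h : (Matrix.of fun i j => ⟪a i, a j⟫_ℂ - ⟪b i, b j⟫_ℂ).PosSemidef) :
    ∃ T : E →L[ℂ] F, ‖T‖ ≤ 1 ∧ ∀ i, T (a i) = b i := by
  have hd : DenseRange (Finsupp.linearCombination ℂ a) := by
    have h1 := Submodule.dense_iff_topologicalClosure_eq_top.2 ha
    rw [← Finsupp.range_linearCombination] at h1
    exact h1
  have hn : ∀ c : ι →₀ ℂ,
      ‖Finsupp.linearCombination ℂ b c‖ ≤ 1 * ‖Finsupp.linearCombination ℂ a c‖ := fun c => by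
    rw [one_mul]; exact norm_le_of_posSemidef a b h c
  refine ⟨(Finsupp.linearCombination ℂ b).extendOfNorm (Finsupp.linearCombination ℂ a),
    LinearMap.opNorm_extendOfNorm_le hd zero_le_one hn, fun i => ?_⟩
  have := LinearMap.extendOfNorm_eq hd ⟨1, hn⟩ (Finsupp.single i 1)
  simpa using this

theorem exists_unitary [CompleteSpace E] (a : ι → E) (b : ι → F)
    (ha : (Submodule.span ℂ (Set.range a)).topologicalClosure = ⊤)
    (hb : (Submodule.span ℂ (Set.range b)).topologicalClosure = ⊤)
    (h : ∀ i j, ⟪a i, a j⟫_ℂ = ⟪b i, b j⟫_ℂ) :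
    ∃ U : E ≃ₗᵢ[ℂ] F, ∀ i, U (a i) = b i := by
  obtain ⟨S, hS, hSa⟩ := exists_contraction a b ha (by
    convert Matrix.PosSemidef.zero using 1; ext i j; simp [h])
  obtain ⟨T, hT, hTb⟩ := exists_contraction b a hb (by
    convert Matrix.PosSemidef.zero using 1; ext i j; simp [h])
  have h1 : T ∘L S = ContinuousLinearMap.id ℂ E := by
    refine ContinuousLinearMap.ext_on (Submodule.dense_iff_topologicalClosure_eq_top.2 ha) ?_
    rintro _ ⟨i, rfl⟩
    simp [hSa, hTb]
  have h2 : S ∘L T = ContinuousLinearMap.id ℂ F := by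
    refine ContinuousLinearMap.ext_on (Submodule.dense_iff_topologicalClosure_eq_top.2 hb) ?_
    rintro _ ⟨i, rfl⟩
    simp [hSa, hTb]
  have h1' : ∀ x, T (S x) = x := fun x => by simpa using DFunLike.congr_fun h1 x
  have h2' : ∀ x, S (T x) = x := fun x => by simpa using DFunLike.congr_fun h2 x
  refine ⟨⟨LinearEquiv.ofLinearMap S.toLinearMap T.toLinearMap (LinearMap.ext h2')
    (LinearMap.ext h1'), fun x => ?_⟩, hSa⟩
  change ‖S x‖ = ‖x‖
  refine le_antisymm ((S.le_of_opNorm_le hS x).trans_eq (one_mul _)) ?_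
  calc ‖x‖ = ‖T (S x)‖ := by rw [h1']
    _ ≤ ‖S x‖ := (T.le_of_opNorm_le hT _).trans_eq (one_mul _)

end Gram

/-! ### Reproducing kernel spaces and multipliers -/

/-- A positive definite kernel on `Λ`: `∑ i, j, conj (c i) * K (λ i) (λ j) * c j ≥ 0` for all
finitely supported families `c`. -/
structure PosKernel (Λ : Type u) where
  toFun : Λ → Λ → ℂ
  posSemidef : (Matrix.of toFun).PosSemidef

namespace PosKernel

variable {Λ : Type u}

instance : CoeFun (PosKernel Λ) (fun _ => Λ → Λ → ℂ) := ⟨toFun⟩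

/-- The kernel `K`, with its values regarded as operators on `ℂ`. -/
def opMatrix (K : PosKernel Λ) : Matrix Λ Λ (ℂ →L[ℂ] ℂ) :=
  Matrix.of fun μ l => K μ l • ContinuousLinearMap.id ℂ ℂ

theorem conj_apply (K : PosKernel Λ) (μ l : Λ) : conj (K l μ) = K μ l :=
  K.posSemidef.isHermitian.apply μ l

theorem posSemidef_opMatrix (K : PosKernel Λ) : K.opMatrix.PosSemidef := by
  have h0 := (RKHS.posSemidef_tfae (K := K.opMatrix)).out 0 2
  refine h0.2 ⟨?_, fun c => ?_⟩
  · ext μ l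
    have h1 : star (ContinuousLinearMap.id ℂ ℂ) = ContinuousLinearMap.id ℂ ℂ :=
      star_one (ℂ →L[ℂ] ℂ)
    simp [opMatrix, K.conj_apply, h1]
  · have h := (Complex.le_def.1 (K.posSemidef.2 c)).1
    rw [Finsupp.sum_comm, Complex.zero_re] at h
    convert h using 1
    simp only [Finsupp.sum, map_sum, Complex.re_sum, RCLike.re_to_complex]
    refine Finset.sum_congr rfl fun i _ => Finset.sum_congr rfl fun j _ => ?_
    simp [opMatrix]
    ring

instance (K : PosKernel Λ) : Fact K.opMatrix.PosSemidef := ⟨K.posSemidef_opMatrix⟩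

/-- The reproducing kernel Hilbert space with kernel `K`. -/
def space (K : PosKernel Λ) : Type u := RKHS.OfKernel K.opMatrix

instance (K : PosKernel Λ) : NormedAddCommGroup K.space :=
  inferInstanceAs (NormedAddCommGroup (RKHS.OfKernel K.opMatrix))

instance (K : PosKernel Λ) : InnerProductSpace ℂ K.space :=
  inferInstanceAs (InnerProductSpace ℂ (RKHS.OfKernel K.opMatrix))

instance (K : PosKernel Λ) : CompleteSpace K.space :=
  inferInstanceAs (CompleteSpace (RKHS.OfKernel K.opMatrix))

instance (K : PosKernel Λ) : RKHS ℂ K.space Λ ℂ :=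
  inferInstanceAs (RKHS ℂ (RKHS.OfKernel K.opMatrix) Λ ℂ)

/-- The reproducing kernel function `k_l`. -/
def k (K : PosKernel Λ) (l : Λ) : K.space := RKHS.kerFun K.space l 1

theorem inner_k (K : PosKernel Λ) (l : Λ) (f : K.space) : ⟪K.k l, f⟫_ℂ = f l := by
  simp [k]

theorem k_apply (K : PosKernel Λ) (l μ : Λ) : K.k l μ = K μ l := by
  have h : RKHS.kernel K.space = K.opMatrix := RKHS.OfKernel.kernel_ofKernel
  simp [k, RKHS.kerFun_apply, h, opMatrix]

theorem inner_k_k (K : PosKernel Λ) (μ l : Λ) : ⟪K.k μ, K.k l⟫_ℂ = K μ l := by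
  rw [inner_k, k_apply]

theorem dense_k (K : PosKernel Λ) :
    (Submodule.span ℂ (Set.range K.k)).topologicalClosure = ⊤ := by
  rw [eq_top_iff, ← RKHS.kerFun_dense K.space]
  refine Submodule.topologicalClosure_mono (Submodule.span_le.2 ?_)
  rintro _ ⟨x, v, rfl⟩
  have : RKHS.kerFun K.space x v = v • K.k x := by
    rw [k, ← map_smul]; simp
  rw [SetLike.mem_coe, this]
  exact Submodule.smul_mem _ _ (Submodule.subset_span ⟨x, rfl⟩)

section Multiplier

variable {𝓖 𝓖' : Type*} [NormedAddCommGroup 𝓖] [InnerProductSpace ℂ 𝓖] [CompleteSpace 𝓖]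
  [NormedAddCommGroup 𝓖'] [InnerProductSpace ℂ 𝓖'] [CompleteSpace 𝓖']

/-- `G` is a contractive multiplier: `k_l ⊗ y ↦ k_l ⊗ G(l)* y` extends to a contraction. -/
def IsContractiveMultiplier (K : PosKernel Λ) (G : Λ → 𝓖' →L[ℂ] 𝓖) : Prop :=
  ∃ T : K.space ⊗ₕ 𝓖 →L[ℂ] K.space ⊗ₕ 𝓖', ‖T‖ ≤ 1 ∧
    ∀ l y, T (HTensor.tmul (K.k l) y) = HTensor.tmul (K.k l) ((G l).adjoint y)

/-- The multiplication operator `𝔪_G`, whose adjoint is the (unique) contractive extension of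
`k_l ⊗ y ↦ k_l ⊗ G(l)* y`. -/
def mulOp {K : PosKernel Λ} {G : Λ → 𝓖' →L[ℂ] 𝓖} (hG : K.IsContractiveMultiplier G) :
    K.space ⊗ₕ 𝓖' →L[ℂ] K.space ⊗ₕ 𝓖 :=
  hG.choose.adjoint

theorem norm_mulOp_le {K : PosKernel Λ} {G : Λ → 𝓖' →L[ℂ] 𝓖}
    (hG : K.IsContractiveMultiplier G) : ‖mulOp hG‖ ≤ 1 := by
  rw [mulOp, LinearIsometryEquiv.norm_map]
  exact hG.choose_spec.1

theorem adjoint_mulOp_tmul {K : PosKernel Λ} {G : Λ → 𝓖' →L[ℂ] 𝓖}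
    (hG : K.IsContractiveMultiplier G) (l : Λ) (y : 𝓖) :
    (mulOp hG).adjoint (HTensor.tmul (K.k l) y) =
      HTensor.tmul (K.k l) ((G l).adjoint y) := by
  rw [mulOp, ContinuousLinearMap.adjoint_adjoint]
  exact hG.choose_spec.2 l y

end Multiplier

/-- The contractively included subspace `𝓜_G`, the range space of `𝔪_G`. -/
def multiplierRange {𝓖 𝓖' : Type u} [NormedAddCommGroup 𝓖] [InnerProductSpace ℂ 𝓖]
    [CompleteSpace 𝓖] [NormedAddCommGroup 𝓖'] [InnerProductSpace ℂ 𝓖'] [CompleteSpace 𝓖']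
    {K : PosKernel Λ} {G : Λ → 𝓖' →L[ℂ] 𝓖} (hG : K.IsContractiveMultiplier G) :
    ContractiveSubspace (K.space ⊗ₕ 𝓖) :=
  ContractiveSubspace.range (mulOp hG) (norm_mulOp_le hG)

/-! ### Pick kernels -/

/-- Pick kernels. -/
structure IsPick (K : PosKernel Λ) : Prop where
  ne_zero : ∀ μ l, K μ l ≠ 0
  posSemidef : ∀ l₀, (Matrix.of fun μ l =>
    1 - K μ l₀ * K l₀ l / (K μ l * K l₀ l₀)).PosSemidef

/-- The normalized kernel function `δ` at the base point `l₀`. -/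
def delta (K : PosKernel Λ) (l₀ : Λ) : K.space := ((‖K.k l₀‖⁻¹ : ℝ) : ℂ) • K.k l₀

theorem IsPick.k_ne_zero {K : PosKernel Λ} (hK : K.IsPick) (l₀ : Λ) : K.k l₀ ≠ 0 := by
  intro h
  have h1 := hK.ne_zero l₀ l₀
  rw [← inner_k_k, h, inner_zero_left] at h1
  exact h1 rfl

theorem IsPick.delta_ne_zero {K : PosKernel Λ} (hK : K.IsPick) (l₀ l : Λ) :
    K.delta l₀ l ≠ 0 := by
  have h : ‖K.k l₀‖ ≠ 0 := norm_ne_zero_iff.2 (hK.k_ne_zero l₀)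
  simp [delta, k_apply, h, hK.ne_zero]

/-- The normalized kernel `K'(μ, l) = K(μ, l) / (δ(μ) * conj δ(l))`. -/
def normalize (K : PosKernel Λ) (l₀ : Λ) : PosKernel Λ where
  toFun μ l := K μ l / (K.delta l₀ μ * conj (K.delta l₀ l))
  posSemidef := by
    convert posSemidef_of_gram (fun l => (conj (K.delta l₀ l))⁻¹ • K.k l) using 2
    ext μ l
    rw [inner_smul_left, inner_smul_right, inner_k_k]
    simp only [map_inv₀, Complex.conj_conj, div_eq_mul_inv, mul_inv]
    ring

theorem normalize_apply (K : PosKernel Λ) (l₀ μ l : Λ) :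
    K.normalize l₀ μ l = K μ l / (K.delta l₀ μ * conj (K.delta l₀ l)) := rfl

theorem exists_omega {K : PosKernel Λ} (hK : K.IsPick) (l₀ : Λ) :
    ∃ Ω : K.space ≃ₗᵢ[ℂ] (K.normalize l₀).space, ∀ f l, Ω f l = f l / K.delta l₀ l := by
  have hδ := hK.delta_ne_zero l₀
  have hδ' : ∀ l, conj (K.delta l₀ l) ≠ 0 := fun l => by simpa using hδ l
  have hd : (Submodule.span ℂ (Set.range fun l =>
      conj (K.delta l₀ l) • (K.normalize l₀).k l)).topologicalClosure = ⊤ := by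
    rw [eq_top_iff, ← (K.normalize l₀).dense_k]
    refine Submodule.topologicalClosure_mono (Submodule.span_le.2 ?_)
    rintro _ ⟨l, rfl⟩
    have h1 : (K.normalize l₀).k l = (conj (K.delta l₀ l))⁻¹ •
        (conj (K.delta l₀ l) • (K.normalize l₀).k l) := by
      rw [smul_smul, inv_mul_cancel₀ (hδ' l), one_smul]
    rw [SetLike.mem_coe, h1]
    exact Submodule.smul_mem _ _ (Submodule.subset_span ⟨l, rfl⟩)
  obtain ⟨U, hU⟩ := exists_unitary K.k
    (fun l => conj (K.delta l₀ l) • (K.normalize l₀).k l) K.dense_k hd (fun μ l => by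
      rw [inner_smul_left, inner_smul_right, inner_k_k, inner_k_k, normalize_apply,
        Complex.conj_conj]
      have := hδ μ
      have := hδ' l
      field_simp)
  refine ⟨U, fun f l => ?_⟩
  have h2 := U.inner_map_map (K.k l) f
  rw [hU, inner_smul_left, inner_k, inner_k, Complex.conj_conj] at h2
  rw [← h2, mul_div_cancel_left₀ _ (hδ l)]

/-- The unitary `Ω f = f / δ` from `H(K)` onto `H(K')`. -/
def omega {K : PosKernel Λ} (hK : K.IsPick) (l₀ : Λ) :
    K.space ≃ₗᵢ[ℂ] (K.normalize l₀).space :=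
  (exists_omega hK l₀).choose

theorem omega_apply {K : PosKernel Λ} (hK : K.IsPick) (l₀ : Λ) (f : K.space) (l : Λ) :
    omega hK l₀ f l = f l / K.delta l₀ l :=
  (exists_omega hK l₀).choose_spec f l

/-- The constant functions belonging to `H(K)`. -/
def constants (K : PosKernel Λ) : Submodule ℂ K.space where
  carrier := {f | ∃ c : ℂ, ∀ l, f l = c}
  zero_mem' := ⟨0, fun l => by simp⟩
  add_mem' := by
    rintro f g ⟨c, hc⟩ ⟨d, hd⟩
    exact ⟨c + d, fun l => by simp [hc, hd]⟩
  smul_mem' := by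
    rintro a f ⟨c, hc⟩
    exact ⟨a * c, fun l => by simp [hc]⟩

theorem isClosed_constants (K : PosKernel Λ) : IsClosed (K.constants : Set K.space) := by
  have h : (K.constants : Set K.space) = ⋂ (l : Λ) (μ : Λ), {f : K.space | f l = f μ} := by
    ext f
    simp only [SetLike.mem_coe, Set.mem_iInter, Set.mem_ofPred_eq]
    constructor
    · rintro ⟨c, hc⟩ l μ
      rw [hc, hc]
    · intro h
      rcases isEmpty_or_nonempty Λ with hΛ | ⟨⟨l⟩⟩
      · exact ⟨0, fun l => (hΛ.false l).elim⟩
      · exact ⟨f l, fun μ => h μ l⟩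
  rw [h]
  exact isClosed_iInter fun l => isClosed_iInter fun μ =>
    isClosed_eq (RKHS.continuous_eval l) (RKHS.continuous_eval μ)

instance (K : PosKernel Λ) : CompleteSpace K.constants :=
  K.isClosed_constants.completeSpace_coe

/-- The orthogonal projection of `H(K)` onto the constant functions. -/
def constProj (K : PosKernel Λ) : K.space →L[ℂ] K.space := K.constants.starProjection

section Shift

variable {𝓑 : Type*} [NormedAddCommGroup 𝓑] [InnerProductSpace ℂ 𝓑]

/-- `β : Λ → 𝓑` is the function associated with the Pick kernel `K` and the base point `l₀`:
`K(μ, l) = δ(μ) * conj δ(l) / (1 - ⟨β(l), β(μ)⟩)`, and the values of `β` span a dense subspace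
of `𝓑`. (The scalar product of Mathlib is linear in the second variable.) -/
structure IsPickFunction (K : PosKernel Λ) (l₀ : Λ) (β : Λ → 𝓑) : Prop where
  eq_div : ∀ μ l, K μ l = K.delta l₀ μ * conj (K.delta l₀ l) / (1 - ⟪β μ, β l⟫_ℂ)
  dense_span : (Submodule.span ℂ (Set.range β)).topologicalClosure = ⊤

/-- Every Pick kernel has an associated function `β`. -/
theorem IsPick.exists_isPickFunction {K : PosKernel Λ} (hK : K.IsPick) (l₀ : Λ) :
    ∃ L : PosKernel Λ, K.IsPickFunction l₀ L.k := by
  refine ⟨⟨_, hK.posSemidef l₀⟩, ⟨fun μ l => ?_, dense_k _⟩⟩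
  have h0 : ‖K.k l₀‖ ≠ 0 := norm_ne_zero_iff.2 (hK.k_ne_zero l₀)
  have h1 : K l₀ l₀ = (‖K.k l₀‖ : ℂ) ^ 2 := by
    rw [← inner_k_k]; exact inner_self_eq_norm_sq_to_K _
  have h2 := hK.ne_zero μ l
  have h3 := hK.ne_zero μ l₀
  have h4 := hK.ne_zero l₀ l
  have h5 : (‖K.k l₀‖ : ℂ) ≠ 0 := by exact_mod_cast h0
  rw [inner_k_k]
  simp only [delta, RKHS.coe_smul, Pi.smul_apply, k_apply, smul_eq_mul, map_mul,
    Complex.conj_ofReal, conj_apply, h1]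
  push_cast
  field_simp
  ring_nf

theorem IsPickFunction.one_sub_mul_normalize {K : PosKernel Λ} (hK : K.IsPick) {l₀ : Λ}
    {β : Λ → 𝓑} (hβ : K.IsPickFunction l₀ β) (μ l : Λ) :
    (1 - ⟪β μ, β l⟫_ℂ) * K.normalize l₀ μ l = 1 := by
  have h1 : 1 - ⟪β μ, β l⟫_ℂ ≠ 0 := fun h => hK.ne_zero μ l (by rw [hβ.eq_div, h, div_zero])
  have h2 := hK.delta_ne_zero l₀ μ
  have h3 : conj (K.delta l₀ l) ≠ 0 := by simpa using hK.delta_ne_zero l₀ l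
  rw [normalize_apply, hβ.eq_div]
  field_simp

theorem exists_adjoint_shift {K : PosKernel Λ} (hK : K.IsPick) {l₀ : Λ}
    {β : Λ → 𝓑} (hβ : K.IsPickFunction l₀ β) :
    ∃ T : (K.normalize l₀).space →L[ℂ] 𝓑 ⊗ₕ (K.normalize l₀).space, ‖T‖ ≤ 1 ∧
      ∀ l, T ((K.normalize l₀).k l) = HTensor.tmul (β l) ((K.normalize l₀).k l) := by
  refine exists_contraction _ _ (K.normalize l₀).dense_k ?_
  convert posSemidef_of_gram (fun _ : Λ => (1 : ℂ)) using 2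
  ext μ l
  rw [HTensor.inner_tmul, inner_k_k]
  have := hβ.one_sub_mul_normalize hK μ l
  simp only [RCLike.inner_apply, map_one, mul_one]
  rw [← this]
  ring

/-- The operator `𝐁 : 𝓑 ⊗ H(K') → H(K')` of multiplication by `B(l) ξ = ⟨ξ, β(l)⟩`. As
`B(l)* 1 = β(l)`, its adjoint is the (unique) contractive extension of `k'_l ↦ β(l) ⊗ k'_l`. -/
def shift {K : PosKernel Λ} (hK : K.IsPick) {l₀ : Λ} {β : Λ → 𝓑}
    (hβ : K.IsPickFunction l₀ β) :
    𝓑 ⊗ₕ (K.normalize l₀).space →L[ℂ] (K.normalize l₀).space :=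
  (exists_adjoint_shift hK hβ).choose.adjoint

theorem norm_shift_le {K : PosKernel Λ} (hK : K.IsPick) {l₀ : Λ} {β : Λ → 𝓑}
    (hβ : K.IsPickFunction l₀ β) : ‖shift hK hβ‖ ≤ 1 := by
  rw [shift, LinearIsometryEquiv.norm_map]
  exact (exists_adjoint_shift hK hβ).choose_spec.1

theorem shift_tmul_apply {K : PosKernel Λ} (hK : K.IsPick) {l₀ : Λ} {β : Λ → 𝓑}
    (hβ : K.IsPickFunction l₀ β) (ξ : 𝓑) (f : (K.normalize l₀).space) (l : Λ) :
    shift hK hβ (HTensor.tmul ξ f) l = ⟪β l, ξ⟫_ℂ * f l := by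
  rw [← inner_k, shift, ContinuousLinearMap.adjoint_inner_right,
    (exists_adjoint_shift hK hβ).choose_spec.2, HTensor.inner_tmul, inner_k]

/-- The operator `𝐁 ⊗ I : 𝓑 ⊗ H(K') ⊗ 𝓖 → H(K') ⊗ 𝓖`. -/
def shiftTensor {K : PosKernel Λ} (hK : K.IsPick) {l₀ : Λ} {β : Λ → 𝓑}
    (hβ : K.IsPickFunction l₀ β) (𝓖 : Type*) [NormedAddCommGroup 𝓖] [InnerProductSpace ℂ 𝓖] :
    𝓑 ⊗ₕ ((K.normalize l₀).space ⊗ₕ 𝓖) →L[ℂ] (K.normalize l₀).space ⊗ₕ 𝓖 :=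
  HTensor.map (shift hK hβ) (ContinuousLinearMap.id ℂ 𝓖) ∘L
    (HTensor.assoc 𝓑 (K.normalize l₀).space 𝓖).toContinuousLinearEquiv.toContinuousLinearMap

end Shift

end PosKernel

end

/-!
Let `i` be the inclusion of `N` and `X = 1 - i i*` its defect. A contractively included `M` with
inclusion `j` has `N` as its complement exactly when `j j* = X`, so (i) asks for a multiplier `G`
with `X = 𝔪_G 𝔪_G*`, i.e. for a factorization
`⟪k_μ ⊗ z, X (k_l ⊗ y)⟫ = K(μ, l) ⟪G(μ)* z, G(l)* y⟫`.
Passing to `K'`, where `K' (1 - ⟪β, β⟫) = 1`, this says that `(1 - ⟪β(μ), β(l)⟫)` times the matrix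
of `X` is a Gram matrix. Since `𝐁*` maps `k_l` to `β(l) ⊗ k_l`, this product is the matrix of
`X - 𝐁 (I ⊗ X) 𝐁*`, so (i) is equivalent to `𝐁 (I ⊗ X) 𝐁* ≤ X`. Finally `𝐁 𝐁* = 1 - π'`, which
turns the inequality into `i i* ≤ π' + R R*` with `R = 𝐁 (I ⊗ i)`; by Douglas' lemma this is the
existence of a contraction `(B̃, T)` with `i = R B̃ + π' T`. As `π' R = 0`, here `π' T = π' i`, and
`T` may be replaced by `π' i`, which gives (ii).
-/

section Operators

open ContinuousLinearMap

variable {𝕜 E F G H : Type*} [RCLike 𝕜]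

theorem exists_contraction_comp_eq_of_norm_le [NormedAddCommGroup E] [InnerProductSpace 𝕜 E]
    [CompleteSpace E] [NormedAddCommGroup F] [NormedSpace 𝕜 F] [CompleteSpace F]
    [NormedAddCommGroup H] [NormedSpace 𝕜 H] (A : H →L[𝕜] E) (B : H →L[𝕜] F)
    (h : ∀ z, ‖B z‖ ≤ ‖A z‖) : ∃ W : E →L[𝕜] F, ‖W‖ ≤ 1 ∧ W ∘L A = B := by
  let R : Submodule 𝕜 E := (LinearMap.range A.toLinearMap).topologicalClosure
  have : CompleteSpace R := (Submodule.isClosed_topologicalClosure _).completeSpace_coe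
  let A' : H →L[𝕜] R := A.codRestrict R fun z => Submodule.le_topologicalClosure _ ⟨z, rfl⟩
  have dense_range : DenseRange A'.toLinearMap := by
    rintro ⟨x, hx⟩
    rw [Topology.IsInducing.subtypeVal.closure_eq_preimage_closure_image, Set.mem_preimage,
      ← Set.range_comp]
    exact hx
  have norm_le : ∀ z, ‖B.toLinearMap z‖ ≤ 1 * ‖A'.toLinearMap z‖ := fun z => by
    rw [one_mul]; exact h z
  let V : R →L[𝕜] F := B.toLinearMap.extendOfNorm A'.toLinearMap
  have norm_V_le : ‖V‖ ≤ 1 := LinearMap.opNorm_extendOfNorm_le dense_range zero_le_one norm_le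
  refine ⟨V ∘L R.orthogonalProjectionOnto, ?_, ?_⟩
  · calc ‖V ∘L R.orthogonalProjectionOnto‖
        ≤ ‖V‖ * ‖R.orthogonalProjectionOnto‖ := opNorm_comp_le _ _
      _ ≤ 1 := mul_le_one₀ norm_V_le (norm_nonneg _) R.orthogonalProjectionOnto_norm_le
  · ext z
    have proj_A : R.orthogonalProjectionOnto (A z) = A' z :=
      R.orthogonalProjectionOnto_mem_subspace_eq_self (A' z)
    rw [comp_apply, comp_apply, proj_A]
    exact LinearMap.extendOfNorm_eq dense_range ⟨1, norm_le⟩ z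

variable [NormedAddCommGroup E] [InnerProductSpace 𝕜 E]
  [NormedAddCommGroup F] [InnerProductSpace 𝕜 F]
  [NormedAddCommGroup G] [InnerProductSpace 𝕜 G]
  [NormedAddCommGroup H] [InnerProductSpace 𝕜 H]

/-- The row operator `[A B]` on the Hilbert space direct sum of `E` and `F`. -/
noncomputable def rowOp (A : E →L[𝕜] H) (B : F →L[𝕜] H) : WithLp 2 (E × F) →L[𝕜] H :=
  A.coprod B ∘L (WithLp.prodContinuousLinearEquiv 2 𝕜 E F).toContinuousLinearMap

theorem rowOp_apply (A : E →L[𝕜] H) (B : F →L[𝕜] H) (p : WithLp 2 (E × F)) :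
    rowOp A B p = A p.fst + B p.snd := rfl

theorem ext_of_inner_eq {ι : Type*} {a : ι → H}
    (ha : (Submodule.span 𝕜 (Set.range a)).topologicalClosure = ⊤) {A B : H →L[𝕜] H}
    (h : ∀ i j, ⟪a i, A (a j)⟫_𝕜 = ⟪a i, B (a j)⟫_𝕜) : A = B := by
  have dense_span := Submodule.dense_iff_topologicalClosure_eq_top.2 ha
  refine ext_on dense_span (Set.forall_mem_range.2 fun j => (innerSL_inj (𝕜 := 𝕜)).1 ?_)
  refine ext_on dense_span (Set.forall_mem_range.2 fun i => ?_)
  rw [innerSL_apply_apply, innerSL_apply_apply, ← inner_conj_symm, h, inner_conj_symm]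

theorem isPositive_of_inner_eq {ι E H : Type*} [NormedAddCommGroup E] [InnerProductSpace ℂ E]
    [NormedAddCommGroup H] [InnerProductSpace ℂ H] {a : ι → H} {g : ι → E}
    (ha : (Submodule.span ℂ (Set.range a)).topologicalClosure = ⊤) {Y : H →L[ℂ] H}
    (h : ∀ i j, ⟪a i, Y (a j)⟫_ℂ = ⟪g i, g j⟫_ℂ) : Y.IsPositive := by
  have dense_range : DenseRange (Finsupp.linearCombination ℂ a) := by
    have := Submodule.dense_iff_topologicalClosure_eq_top.2 ha
    rwa [← Finsupp.range_linearCombination] at this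
  have inner_map_linearCombination (c : ι →₀ ℂ) :
      ⟪Finsupp.linearCombination ℂ a c, Y (Finsupp.linearCombination ℂ a c)⟫_ℂ =
        ⟪Finsupp.linearCombination ℂ g c, Finsupp.linearCombination ℂ g c⟫_ℂ := by
    simp only [Finsupp.linearCombination_apply, Finsupp.sum, map_sum, map_smul, sum_inner,
      inner_sum, inner_smul_left, inner_smul_right, h]
  have inner_map_nonneg (z : H) : 0 ≤ ⟪z, Y z⟫_ℂ := by
    refine dense_range.induction_on (p := fun z => 0 ≤ ⟪z, Y z⟫_ℂ) z
      (isClosed_le continuous_const (by fun_prop)) fun c => ?_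
    rw [inner_map_linearCombination, inner_self_eq_norm_sq_to_K, ← RCLike.ofReal_pow]
    exact RCLike.ofReal_nonneg.2 (sq_nonneg _)
  refine (isPositive_iff_complex Y).2 fun z => ?_
  obtain ⟨re_nonneg, im_eq_zero⟩ := Complex.nonneg_iff.1 (inner_map_nonneg z)
  rw [← inner_conj_symm, Complex.conj_eq_iff_im.2 im_eq_zero.symm]
  exact ⟨Complex.conj_eq_iff_re.1 (Complex.conj_eq_iff_im.2 im_eq_zero.symm), re_nonneg⟩

variable [CompleteSpace E] [CompleteSpace F] [CompleteSpace G] [CompleteSpace H]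

theorem comp_adjoint_le_comp_adjoint_iff_norm_le {A : E →L[𝕜] H} {B : F →L[𝕜] H} :
    B ∘L B.adjoint ≤ A ∘L A.adjoint ↔ ∀ z, ‖B.adjoint z‖ ≤ ‖A.adjoint z‖ := by
  have re_inner_sub (z : H) : (A ∘L A.adjoint - B ∘L B.adjoint).reApplyInnerSelf z =
      ‖A.adjoint z‖ ^ 2 - ‖B.adjoint z‖ ^ 2 := by
    rw [reApplyInnerSelf_apply, sub_apply, comp_apply, comp_apply, inner_sub_left, map_sub,
      ← adjoint_inner_right A, ← adjoint_inner_right B, inner_self_eq_norm_sq,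
      inner_self_eq_norm_sq]
  have isSelfAdjoint_sub : IsSelfAdjoint (A ∘L A.adjoint - B ∘L B.adjoint) :=
    (isPositive_self_comp_adjoint A).isSelfAdjoint.sub
      (isPositive_self_comp_adjoint B).isSelfAdjoint
  simp only [le_def, isPositive_def', isSelfAdjoint_sub, re_inner_sub, true_and, sub_nonneg,
    sq_le_sq₀ (norm_nonneg _) (norm_nonneg _)]

/-- Douglas' factorization lemma. -/
theorem comp_adjoint_le_comp_adjoint_iff_exists_contraction {A : E →L[𝕜] H} {B : F →L[𝕜] H} :
    B ∘L B.adjoint ≤ A ∘L A.adjoint ↔ ∃ W : F →L[𝕜] E, ‖W‖ ≤ 1 ∧ A ∘L W = B := by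
  rw [comp_adjoint_le_comp_adjoint_iff_norm_le]
  constructor
  · intro h
    obtain ⟨V, hV, hVA⟩ := exists_contraction_comp_eq_of_norm_le A.adjoint B.adjoint h
    refine ⟨V.adjoint, (LinearIsometryEquiv.norm_map _ V).trans_le hV, ?_⟩
    rw [← adjoint_adjoint B, ← hVA, adjoint_comp, adjoint_adjoint]
  · rintro ⟨W, hW, rfl⟩ z
    rw [adjoint_comp, comp_apply, ← one_mul ‖A.adjoint z‖]
    exact le_of_opNorm_le _ ((LinearIsometryEquiv.norm_map _ W).trans_le hW) _

theorem adjoint_rowOp_apply (A : E →L[𝕜] H) (B : F →L[𝕜] H) (z : H) :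
    (rowOp A B).adjoint z = WithLp.toLp 2 (A.adjoint z, B.adjoint z) := by
  refine ext_inner_right 𝕜 fun p => ?_
  rw [adjoint_inner_left, rowOp_apply, inner_add_right, ← adjoint_inner_left, ← adjoint_inner_left,
    WithLp.prod_inner_apply]
  rfl

theorem rowOp_comp_adjoint (A : E →L[𝕜] H) (B : F →L[𝕜] H) :
    rowOp A B ∘L (rowOp A B).adjoint = A ∘L A.adjoint + B ∘L B.adjoint := by
  ext z
  rw [comp_apply, adjoint_rowOp_apply, rowOp_apply]
  rfl

theorem comp_adjoint_le_add_iff_exists_column {A : E →L[𝕜] H} {B : F →L[𝕜] H} {D : G →L[𝕜] H} :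
    D ∘L D.adjoint ≤ A ∘L A.adjoint + B ∘L B.adjoint ↔
      ∃ (W₁ : G →L[𝕜] E) (W₂ : G →L[𝕜] F),
        (∀ x, ‖W₁ x‖ ^ 2 + ‖W₂ x‖ ^ 2 ≤ ‖x‖ ^ 2) ∧ ∀ x, D x = A (W₁ x) + B (W₂ x) := by
  rw [← rowOp_comp_adjoint, comp_adjoint_le_comp_adjoint_iff_exists_contraction]
  constructor
  · rintro ⟨W, hW, rfl⟩
    refine ⟨WithLp.fstL 2 𝕜 E F ∘L W, WithLp.sndL 2 𝕜 E F ∘L W, fun x => ?_, fun x => rfl⟩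
    have norm_W_le : ‖W x‖ ≤ ‖x‖ := by simpa only [one_mul] using W.le_of_opNorm_le hW x
    rwa [← sq_le_sq₀ (norm_nonneg _) (norm_nonneg _), WithLp.prod_norm_sq_eq_of_L2] at norm_W_le
  · rintro ⟨W₁, W₂, hW, hD⟩
    refine ⟨(WithLp.prodContinuousLinearEquiv 2 𝕜 E F).symm.toContinuousLinearMap ∘L W₁.prod W₂,
      opNorm_le_bound _ zero_le_one fun x => ?_, ContinuousLinearMap.ext fun x => (hD x).symm⟩
    rw [one_mul, ← sq_le_sq₀ (norm_nonneg _) (norm_nonneg _), WithLp.prod_norm_sq_eq_of_L2]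
    exact hW x

theorem comp_eq_zero_of_comp_adjoint_eq_one_sub {Q : H →L[𝕜] H} (hQ : IsStarProjection Q)
    {S : E →L[𝕜] H} (hS : S ∘L S.adjoint = 1 - Q) : Q ∘L S = 0 := by
  have one_sub_comp_Q : (1 - Q) ∘L Q = 0 := hQ.isIdempotentElem.one_sub_mul_self
  have adjoint_comp_Q : S.adjoint ∘L Q = 0 := by
    rw [← adjoint_comp_self_eq_zero_iff, adjoint_comp, adjoint_adjoint, comp_assoc,
      ← comp_assoc S, hS, one_sub_comp_Q, comp_zero]
  rw [← adjoint_adjoint S, ← hQ.isSelfAdjoint.adjoint_eq, ← adjoint_comp, adjoint_comp_Q, map_zero]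

theorem exists_lift_iff_comp_adjoint_le {Q : H →L[𝕜] H} (hQ : IsStarProjection Q)
    {R : F →L[𝕜] H} (hQR : Q ∘L R = 0) {D : E →L[𝕜] H} :
    (∃ W : E →L[𝕜] F, ‖W‖ ≤ 1 ∧
      ∀ x, D x = R (W x) + Q (D x) ∧ ‖W x‖ ^ 2 ≤ ‖x‖ ^ 2 - ‖Q (D x)‖ ^ 2) ↔
    D ∘L D.adjoint ≤ Q + R ∘L R.adjoint := by
  have Q_comp_adjoint : Q ∘L Q.adjoint = Q := by
    rw [hQ.isSelfAdjoint.adjoint_eq]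
    exact hQ.isIdempotentElem
  have Q_apply_Q (x : H) : Q (Q x) = Q x := DFunLike.congr_fun hQ.isIdempotentElem x
  have Q_apply_R (y : F) : Q (R y) = 0 := DFunLike.congr_fun hQR y
  nth_rw 3 [← Q_comp_adjoint]
  rw [comp_adjoint_le_add_iff_exists_column]
  constructor
  · rintro ⟨W, -, hW⟩
    refine ⟨Q ∘L D, W, fun x => ?_, fun x => ?_⟩
    · rw [comp_apply]
      linarith [(hW x).2]
    · rw [comp_apply, Q_apply_Q, add_comm]
      exact (hW x).1
  · rintro ⟨W₁, W₂, hW, hD⟩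
    have Q_apply_D (x : E) : Q (D x) = Q (W₁ x) := by
      rw [hD, map_add, Q_apply_Q, Q_apply_R, add_zero]
    have norm_Q_le (x : E) : ‖Q (W₁ x)‖ ^ 2 ≤ ‖W₁ x‖ ^ 2 := by
      gcongr
      simpa only [one_mul] using Q.le_of_opNorm_le hQ.norm_le (W₁ x)
    refine ⟨W₂, opNorm_le_bound _ zero_le_one fun x => ?_, fun x => ⟨?_, ?_⟩⟩
    · rw [one_mul, ← sq_le_sq₀ (norm_nonneg _) (norm_nonneg _)]
      linarith [hW x, sq_nonneg ‖W₁ x‖]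
    · rw [Q_apply_D, add_comm]
      exact hD x
    · rw [Q_apply_D]
      linarith [hW x, norm_Q_le x]

theorem adjoint_apply_apply_eq_self_of_norm_eq {C : E →L[𝕜] H} (hC : ‖C‖ ≤ 1) {x : E}
    (hx : ‖C x‖ = ‖x‖) : C.adjoint (C x) = x := by
  have norm_adjoint_le : ‖C.adjoint (C x)‖ ≤ ‖x‖ := by
    rw [← hx, ← one_mul ‖C x‖]
    exact le_of_opNorm_le _ ((LinearIsometryEquiv.norm_map _ C).trans_le hC) _
  have norm_sub_sq_eq := norm_sub_sq (𝕜 := 𝕜) (C.adjoint (C x)) x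
  rw [adjoint_inner_left, inner_self_eq_norm_sq, hx] at norm_sub_sq_eq
  have norm_sub_eq_zero : ‖C.adjoint (C x) - x‖ = 0 := by
    nlinarith [norm_nonneg (C.adjoint (C x)), norm_nonneg x, norm_nonneg (C.adjoint (C x) - x)]
  exact sub_eq_zero.1 (norm_eq_zero.1 norm_sub_eq_zero)

theorem comp_adjoint_eq_one_iff_existsUnique {C : E →L[𝕜] H} :
    C ∘L C.adjoint = 1 ↔ ‖C‖ ≤ 1 ∧ ∀ z, ∃! x, z = C x ∧ ‖z‖ = ‖x‖ := by
  constructor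
  · intro h
    have apply_adjoint (z : H) : C (C.adjoint z) = z := DFunLike.congr_fun h z
    have norm_adjoint (z : H) : ‖C.adjoint z‖ = ‖z‖ := by
      rw [← sq_eq_sq₀ (norm_nonneg _) (norm_nonneg _), ← inner_self_eq_norm_sq (𝕜 := 𝕜),
        adjoint_inner_left, apply_adjoint, inner_self_eq_norm_sq]
    have norm_le_one : ‖C‖ ≤ 1 := by
      rw [← LinearIsometryEquiv.norm_map adjoint C]
      exact opNorm_le_bound _ zero_le_one fun z => by rw [one_mul, norm_adjoint]
    refine ⟨norm_le_one, fun z => ⟨C.adjoint z, ⟨?_, (norm_adjoint z).symm⟩, ?_⟩⟩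
    · exact (apply_adjoint z).symm
    · rintro x ⟨rfl, hx⟩
      exact (adjoint_apply_apply_eq_self_of_norm_eq norm_le_one hx).symm
  · rintro ⟨hC, h⟩
    ext z
    obtain ⟨x, ⟨rfl, hx⟩, -⟩ := h z
    rw [comp_apply, adjoint_apply_apply_eq_self_of_norm_eq hC hx]
    rfl

end Operators

namespace HTensor

variable {E F E' F' E'' F'' : Type*} [NormedAddCommGroup E] [InnerProductSpace ℂ E]
  [NormedAddCommGroup F] [InnerProductSpace ℂ F] [NormedAddCommGroup E'] [InnerProductSpace ℂ E']
  [NormedAddCommGroup F'] [InnerProductSpace ℂ F'] [NormedAddCommGroup E'']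
  [InnerProductSpace ℂ E''] [NormedAddCommGroup F''] [InnerProductSpace ℂ F'']

/-- `HTensor.tmul` as a continuous bilinear map. -/
noncomputable def tmulL : E →L[ℂ] F →L[ℂ] E ⊗ₕ F :=
  ContinuousLinearMap.compL ℂ F (E ⊗[ℂ] F) (E ⊗ₕ F) (incl E F).toContinuousLinearMap ∘L
    TensorProduct.mkL ℂ E F

theorem tmulL_apply (x : E) (y : F) : tmulL x y = tmul x y := rfl

theorem ext_tmul {A B : E ⊗ₕ F →L[ℂ] E'} (h : ∀ x y, A (tmul x y) = B (tmul x y)) : A = B := by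
  have comp_incl_eq : A.toLinearMap ∘ₗ (incl E F).toLinearMap =
      B.toLinearMap ∘ₗ (incl E F).toLinearMap := TensorProduct.ext' h
  exact DFunLike.ext' ((denseRange_incl E F).equalizer A.continuous B.continuous
    (funext (LinearMap.congr_fun comp_incl_eq)))

theorem topologicalClosure_span_range_tmul {ι : Type*} {a : ι → E}
    (ha : (Submodule.span ℂ (Set.range a)).topologicalClosure = ⊤) :
    (Submodule.span ℂ (Set.range fun p : ι × F => tmul (a p.1) p.2)).topologicalClosure = ⊤ := by
  set S := (Submodule.span ℂ (Set.range fun p : ι × F => tmul (a p.1) p.2)).topologicalClosure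
  have isClosed_S : IsClosed (S : Set (E ⊗ₕ F)) := Submodule.isClosed_topologicalClosure _
  have tmul_mem (x : E) (y : F) : tmul x y ∈ S := by
    have le_comap : (Submodule.span ℂ (Set.range a)).topologicalClosure ≤
        S.comap (tmulL.flip y).toLinearMap := by
      refine Submodule.topologicalClosure_minimal _ (Submodule.span_le.2 ?_)
        (isClosed_S.preimage (tmulL.flip y).continuous)
      rintro _ ⟨i, rfl⟩
      exact Submodule.le_topologicalClosure _ (Submodule.subset_span ⟨(i, y), rfl⟩)
    exact le_comap (ha ▸ Submodule.mem_top)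
  refine Submodule.eq_top_iff'.2 fun w =>
    (denseRange_incl E F).induction_on (p := (· ∈ S)) w isClosed_S fun z => ?_
  induction z using TensorProduct.induction_on with
  | zero => exact (map_zero (incl E F)).symm ▸ S.zero_mem
  | tmul x y => exact tmul_mem x y
  | add u v hu hv => exact (map_add (incl E F) u v).symm ▸ S.add_mem hu hv

theorem map_comp (S' : E' →L[ℂ] E'') (T' : F' →L[ℂ] F'') (S : E →L[ℂ] E') (T : F →L[ℂ] F') :
    map S' T' ∘L map S T = map (S' ∘L S) (T' ∘L T) :=
  ext_tmul fun x y => by simp only [ContinuousLinearMap.comp_apply, map_tmul]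

theorem map_one : map (1 : E →L[ℂ] E) (1 : F →L[ℂ] F) = 1 :=
  ext_tmul fun x y => map_tmul _ _ x y

theorem map_sub_right (S : E →L[ℂ] E') (T T' : F →L[ℂ] F') :
    map S (T - T') = map S T - map S T' :=
  ext_tmul fun x y => by
    rw [sub_apply, map_tmul, map_tmul, map_tmul, sub_apply, ← tmulL_apply, _root_.map_sub]
    rfl

theorem adjoint_map [CompleteSpace E] [CompleteSpace F] [CompleteSpace E'] [CompleteSpace F']
    (S : E →L[ℂ] E') (T : F →L[ℂ] F') : (map S T).adjoint = map S.adjoint T.adjoint := by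
  refine ext_tmul fun x y => innerSL_inj.1 (ext_tmul fun x' y' => ?_)
  simp only [innerSL_apply_apply, ContinuousLinearMap.adjoint_inner_left, map_tmul, inner_tmul]

theorem isStarProjection_map [CompleteSpace E] [CompleteSpace F] {P : E →L[ℂ] E}
    {Q : F →L[ℂ] F} (hP : IsStarProjection P) (hQ : IsStarProjection Q) :
    IsStarProjection (map P Q) where
  isIdempotentElem := (map_comp P Q P Q).trans
    (congrArg₂ map hP.isIdempotentElem.eq hQ.isIdempotentElem.eq)
  isSelfAdjoint := (adjoint_map P Q).trans
    (congrArg₂ map hP.isSelfAdjoint.adjoint_eq hQ.isSelfAdjoint.adjoint_eq)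

end HTensor

section RowConj

variable {𝓑 E H : Type*} [NormedAddCommGroup 𝓑] [InnerProductSpace ℂ 𝓑]
  [NormedAddCommGroup E] [InnerProductSpace ℂ E] [CompleteSpace E]
  [NormedAddCommGroup H] [InnerProductSpace ℂ H] [CompleteSpace H]

/-- The completely positive map `X ↦ S (I ⊗ X) S*` given by an operator `S : 𝓑 ⊗ H → H`, i.e.
`X ↦ ∑ i, S i * X * (S i)*` in terms of the components of `S` in an orthonormal basis of `𝓑`. -/
noncomputable def rowConj (S : 𝓑 ⊗ₕ H →L[ℂ] H) (X : H →L[ℂ] H) : H →L[ℂ] H :=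
  S ∘L HTensor.map (ContinuousLinearMap.id ℂ 𝓑) X ∘L S.adjoint

theorem inner_sub_rowConj_apply {S : 𝓑 ⊗ₕ H →L[ℂ] H} (X : H →L[ℂ] H) {x y : H} {b c : 𝓑}
    (hx : S.adjoint x = HTensor.tmul b x) (hy : S.adjoint y = HTensor.tmul c y) :
    ⟪x, (X - rowConj S X) y⟫_ℂ = (1 - ⟪b, c⟫_ℂ) * ⟪x, X y⟫_ℂ := by
  have inner_rowConj : ⟪x, rowConj S X y⟫_ℂ = ⟪b, c⟫_ℂ * ⟪x, X y⟫_ℂ := by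
    rw [rowConj, ContinuousLinearMap.comp_apply, ContinuousLinearMap.comp_apply,
      ← ContinuousLinearMap.adjoint_inner_left, hx, hy, HTensor.map_tmul, HTensor.inner_tmul,
      ContinuousLinearMap.id_apply]
  rw [sub_apply, inner_sub_right, inner_rowConj, sub_mul, one_mul]

theorem rowConj_one_sub_comp_adjoint [CompleteSpace 𝓑] (S : 𝓑 ⊗ₕ H →L[ℂ] H) (D : E →L[ℂ] H) :
    rowConj S (1 - D ∘L D.adjoint) = S ∘L S.adjoint -
      (S ∘L HTensor.map (ContinuousLinearMap.id ℂ 𝓑) D) ∘L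
        (S ∘L HTensor.map (ContinuousLinearMap.id ℂ 𝓑) D).adjoint := by
  have adjoint_id : (ContinuousLinearMap.id ℂ 𝓑).adjoint = ContinuousLinearMap.id ℂ 𝓑 := star_one _
  have map_comp_adjoint : HTensor.map (ContinuousLinearMap.id ℂ 𝓑) (D ∘L D.adjoint) =
      HTensor.map (ContinuousLinearMap.id ℂ 𝓑) D ∘L
        (HTensor.map (ContinuousLinearMap.id ℂ 𝓑) D).adjoint := by
    rw [HTensor.adjoint_map, HTensor.map_comp, adjoint_id, ContinuousLinearMap.comp_id]
  have map_id_one : HTensor.map (ContinuousLinearMap.id ℂ 𝓑) (1 : H →L[ℂ] H) = 1 :=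
    HTensor.map_one
  rw [rowConj, HTensor.map_sub_right, map_id_one, map_comp_adjoint, ContinuousLinearMap.sub_comp,
    ContinuousLinearMap.comp_sub, ContinuousLinearMap.adjoint_comp, ContinuousLinearMap.one_def,
    ContinuousLinearMap.id_comp]
  rfl

theorem rowConj_one_sub_comp_adjoint_le_iff [CompleteSpace 𝓑] {S : 𝓑 ⊗ₕ H →L[ℂ] H}
    {Q : H →L[ℂ] H} (hQ : IsStarProjection Q) (hS : S ∘L S.adjoint = 1 - Q) {D : E →L[ℂ] H} :
    rowConj S (1 - D ∘L D.adjoint) ≤ 1 - D ∘L D.adjoint ↔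
      ∃ W : E →L[ℂ] 𝓑 ⊗ₕ E, ‖W‖ ≤ 1 ∧ ∀ x,
        D x = S (HTensor.map (ContinuousLinearMap.id ℂ 𝓑) D (W x)) + Q (D x) ∧
        ‖W x‖ ^ 2 ≤ ‖x‖ ^ 2 - ‖Q (D x)‖ ^ 2 := by
  have Q_comp_R : Q ∘L (S ∘L HTensor.map (ContinuousLinearMap.id ℂ 𝓑) D) = 0 := by
    rw [← ContinuousLinearMap.comp_assoc, comp_eq_zero_of_comp_adjoint_eq_one_sub hQ hS,
      ContinuousLinearMap.zero_comp]
  rw [rowConj_one_sub_comp_adjoint, hS]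
  refine Iff.trans ?_ (exists_lift_iff_comp_adjoint_le hQ Q_comp_R).symm
  rw [sub_sub, sub_le_sub_iff_left]

end RowConj

namespace ContractiveSubspace

variable {H H' : Type u} [NormedAddCommGroup H] [InnerProductSpace ℂ H] [CompleteSpace H]
  [NormedAddCommGroup H'] [InnerProductSpace ℂ H'] [CompleteSpace H']

/-- The defect operator `I - i i*` of the inclusion `i` of a contractively included subspace. -/
noncomputable def defect (N : ContractiveSubspace H) : H →L[ℂ] H := 1 - N.incl ∘L N.incl.adjoint

theorem isComplement_iff {M N : ContractiveSubspace H} :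
    M.IsComplement N ↔ M.incl ∘L M.incl.adjoint = N.defect := by
  have norm_rowOp_le_iff : ‖rowOp M.incl N.incl‖ ≤ 1 ↔ ∀ (x : M.Space) (y : N.Space),
      ‖M.incl x + N.incl y‖ ^ 2 ≤ ‖x‖ ^ 2 + ‖y‖ ^ 2 := by
    rw [ContinuousLinearMap.opNorm_le_iff zero_le_one, (WithLp.equiv 2 _).forall_congr_left,
      Prod.forall]
    refine forall₂_congr fun x y => ?_
    rw [one_mul, ← sq_le_sq₀ (norm_nonneg _) (norm_nonneg _), WithLp.prod_norm_sq_eq_of_L2]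
    rfl
  have existsUnique_iff (z : H) : (∃! p, z = rowOp M.incl N.incl p ∧ ‖z‖ = ‖p‖) ↔
      ∃! p : M.Space × N.Space,
        z = M.incl p.1 + N.incl p.2 ∧ ‖z‖ ^ 2 = ‖p.1‖ ^ 2 + ‖p.2‖ ^ 2 := by
    refine (WithLp.equiv 2 (M.Space × N.Space)).existsUnique_congr fun p => ?_
    rw [rowOp_apply, ← sq_eq_sq₀ (norm_nonneg _) (norm_nonneg _), WithLp.prod_norm_sq_eq_of_L2]
    rfl
  rw [defect, eq_sub_iff_add_eq, ← rowOp_comp_adjoint, comp_adjoint_eq_one_iff_existsUnique,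
    norm_rowOp_le_iff, forall_congr' existsUnique_iff]
  exact ⟨fun h => ⟨h.1, h.2⟩, fun h => ⟨h.1, h.2⟩⟩

theorem range_incl_comp_adjoint {E : Type u} [NormedAddCommGroup E] [InnerProductSpace ℂ E]
    [CompleteSpace E] (C : E →L[ℂ] H) (hC : ‖C‖ ≤ 1) :
    (range C hC).incl ∘L (range C hC).incl.adjoint = C ∘L C.adjoint := by
  set V := (LinearMap.ker C.toLinearMap)ᗮ
  have adjoint_mem (z : H) : C.adjoint z ∈ V := fun x (hx : C x = 0) => by
    rw [ContinuousLinearMap.adjoint_inner_right, hx, inner_zero_left]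
  ext z
  calc (C ∘L V.subtypeL) ((C ∘L V.subtypeL).adjoint z)
      = C (V.starProjection (C.adjoint z)) := by
        rw [ContinuousLinearMap.adjoint_comp, Submodule.adjoint_subtypeL]
        rfl
    _ = C (C.adjoint z) := by rw [Submodule.starProjection_eq_self_iff.2 (adjoint_mem z)]

theorem adjoint_incl_image (N : ContractiveSubspace H) (U : H ≃ₗᵢ[ℂ] H') (z : H) :
    (N.image U).incl.adjoint (U z) = N.toImage U (N.incl.adjoint z) := by
  refine ext_inner_right ℂ fun x => ?_
  obtain ⟨x, rfl⟩ := (N.toImage U).surjective x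
  rw [ContinuousLinearMap.adjoint_inner_left, incl_toImage, LinearIsometryEquiv.inner_map_map,
    LinearIsometryEquiv.inner_map_map, ContinuousLinearMap.adjoint_inner_left]

theorem defect_image_apply (N : ContractiveSubspace H) (U : H ≃ₗᵢ[ℂ] H') (z : H) :
    (N.image U).defect (U z) = U (N.defect z) := by
  calc U z - (N.image U).incl ((N.image U).incl.adjoint (U z))
      = U z - U (N.incl (N.incl.adjoint z)) := by rw [adjoint_incl_image, incl_toImage]
    _ = U (z - N.incl (N.incl.adjoint z)) := (map_sub U _ _).symm

end ContractiveSubspace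

namespace PosKernel

open ContinuousLinearMap

variable {Λ : Type u}

section MultiplierSquare

variable {𝓖 𝓖' : Type*} [NormedAddCommGroup 𝓖] [InnerProductSpace ℂ 𝓖] [CompleteSpace 𝓖]
  [NormedAddCommGroup 𝓖'] [InnerProductSpace ℂ 𝓖'] [CompleteSpace 𝓖']

/-- `X` has, on the total family of the `k_l ⊗ y`, the matrix that `𝔪_G 𝔪_G*` would have if `G`
were a multiplier. -/
def IsMultiplierSquare (K : PosKernel Λ) (G : Λ → 𝓖' →L[ℂ] 𝓖)
    (X : K.space ⊗ₕ 𝓖 →L[ℂ] K.space ⊗ₕ 𝓖) : Prop :=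
  ∀ μ l z y, ⟪HTensor.tmul (K.k μ) z, X (HTensor.tmul (K.k l) y)⟫_ℂ =
    K μ l * ⟪(G μ).adjoint z, (G l).adjoint y⟫_ℂ

theorem isMultiplierSquare_mulOp {K : PosKernel Λ} {G : Λ → 𝓖' →L[ℂ] 𝓖}
    (hG : K.IsContractiveMultiplier G) :
    K.IsMultiplierSquare G (mulOp hG ∘L (mulOp hG).adjoint) := fun μ l z y => by
  rw [comp_apply, ← adjoint_inner_left, adjoint_mulOp_tmul, adjoint_mulOp_tmul,
    HTensor.inner_tmul, inner_k_k]

theorem IsMultiplierSquare.unique {K : PosKernel Λ} {G : Λ → 𝓖' →L[ℂ] 𝓖}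
    {X Y : K.space ⊗ₕ 𝓖 →L[ℂ] K.space ⊗ₕ 𝓖} (hX : K.IsMultiplierSquare G X)
    (hY : K.IsMultiplierSquare G Y) : X = Y :=
  ext_of_inner_eq (HTensor.topologicalClosure_span_range_tmul K.dense_k) fun p q =>
    (hX p.1 q.1 p.2 q.2).trans (hY p.1 q.1 p.2 q.2).symm

theorem IsMultiplierSquare.isContractiveMultiplier {K : PosKernel Λ} {G : Λ → 𝓖' →L[ℂ] 𝓖}
    {E : Type*} [NormedAddCommGroup E] [InnerProductSpace ℂ E] [CompleteSpace E]
    {D : E →L[ℂ] K.space ⊗ₕ 𝓖} (h : K.IsMultiplierSquare G (1 - D ∘L D.adjoint)) :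
    K.IsContractiveMultiplier G := by
  obtain ⟨T, hT, hTk⟩ := exists_contraction
    (fun p : Λ × 𝓖 => HTensor.tmul (K.k p.1) p.2)
    (fun p : Λ × 𝓖 => HTensor.tmul (K.k p.1) ((G p.1).adjoint p.2))
    (HTensor.topologicalClosure_span_range_tmul K.dense_k) (by
      convert posSemidef_of_gram
        fun p : Λ × 𝓖 => D.adjoint (HTensor.tmul (K.k p.1) p.2) using 2
      ext p q
      rw [HTensor.inner_tmul (K.k p.1) (K.k q.1) ((G p.1).adjoint p.2), inner_k_k, ← h, sub_apply,
        inner_sub_right, adjoint_inner_left]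
      exact sub_sub_cancel _ _)
  exact ⟨T, hT, fun l y => hTk (l, y)⟩

theorem exists_isComplement_iff {Λ 𝓖 𝓖' : Type u} [NormedAddCommGroup 𝓖] [InnerProductSpace ℂ 𝓖]
    [CompleteSpace 𝓖] [NormedAddCommGroup 𝓖'] [InnerProductSpace ℂ 𝓖'] [CompleteSpace 𝓖']
    {K : PosKernel Λ} {G : Λ → 𝓖' →L[ℂ] 𝓖} {N : ContractiveSubspace (K.space ⊗ₕ 𝓖)} :
    (∃ hG : K.IsContractiveMultiplier G, (multiplierRange hG).IsComplement N) ↔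
      K.IsMultiplierSquare G N.defect := by
  simp only [ContractiveSubspace.isComplement_iff, multiplierRange,
    ContractiveSubspace.range_incl_comp_adjoint]
  constructor
  · rintro ⟨hG, h⟩
    exact h ▸ isMultiplierSquare_mulOp hG
  · intro h
    have hG : K.IsContractiveMultiplier G := h.isContractiveMultiplier
    exact ⟨hG, (isMultiplierSquare_mulOp hG).unique h⟩

theorem omega_k {K : PosKernel Λ} (hK : K.IsPick) (l₀ l : Λ) :
    omega hK l₀ (K.k l) = conj (K.delta l₀ l) • (K.normalize l₀).k l := by
  refine RKHS.ext fun μ => ?_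
  have conj_delta_ne_zero : conj (K.delta l₀ l) ≠ 0 :=
    (map_ne_zero _).2 (hK.delta_ne_zero l₀ l)
  rw [omega_apply, RKHS.coe_smul, Pi.smul_apply, k_apply, k_apply, normalize_apply, smul_eq_mul]
  field_simp

theorem isMultiplierSquare_normalize_iff {K : PosKernel Λ} (hK : K.IsPick) {l₀ : Λ}
    {G : Λ → 𝓖' →L[ℂ] 𝓖} {X : K.space ⊗ₕ 𝓖 →L[ℂ] K.space ⊗ₕ 𝓖}
    {X' : (K.normalize l₀).space ⊗ₕ 𝓖 →L[ℂ] (K.normalize l₀).space ⊗ₕ 𝓖}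
    (hX : ∀ z, X' (HTensor.congrLeft (omega hK l₀) 𝓖 z) =
      HTensor.congrLeft (omega hK l₀) 𝓖 (X z)) :
    (K.normalize l₀).IsMultiplierSquare G X' ↔ K.IsMultiplierSquare G X := by
  refine forall₄_congr fun μ l z y => ?_
  have delta_ne_zero := hK.delta_ne_zero l₀ μ
  have conj_delta_ne_zero : conj (K.delta l₀ l) ≠ 0 :=
    (map_ne_zero _).2 (hK.delta_ne_zero l₀ l)
  have congrLeft_tmul (l : Λ) (y : 𝓖) : HTensor.congrLeft (omega hK l₀) 𝓖
      (HTensor.tmul (K.k l) y) = conj (K.delta l₀ l) • HTensor.tmul ((K.normalize l₀).k l) y := by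
    rw [HTensor.congrLeft_tmul, omega_k, ← HTensor.tmulL_apply, map_smul]
    rfl
  rw [← (HTensor.congrLeft (omega hK l₀) 𝓖).inner_map_map, ← hX, congrLeft_tmul, congrLeft_tmul,
    map_smul, inner_smul_left, inner_smul_right, Complex.conj_conj, normalize_apply]
  constructor
  · intro h
    rw [h]
    field_simp
  · intro h
    rw [div_mul_eq_mul_div, eq_div_iff (mul_ne_zero delta_ne_zero conj_delta_ne_zero), ← h]
    ring

end MultiplierSquare

theorem exists_isMultiplierSquare_iff_rowConj_le {Λ 𝓖 : Type u} {𝓑 : Type*}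
    [NormedAddCommGroup 𝓑] [InnerProductSpace ℂ 𝓑] [NormedAddCommGroup 𝓖]
    [InnerProductSpace ℂ 𝓖] [CompleteSpace 𝓖] {K : PosKernel Λ} {β : Λ → 𝓑}
    (hβ : ∀ μ l, (1 - ⟪β μ, β l⟫_ℂ) * K μ l = 1)
    {S : 𝓑 ⊗ₕ (K.space ⊗ₕ 𝓖) →L[ℂ] K.space ⊗ₕ 𝓖}
    (hS : ∀ l y, S.adjoint (HTensor.tmul (K.k l) y) =
      HTensor.tmul (β l) (HTensor.tmul (K.k l) y))
    {X : K.space ⊗ₕ 𝓖 →L[ℂ] K.space ⊗ₕ 𝓖} :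
    (∃ (𝓖' : Type u) (_ : NormedAddCommGroup 𝓖') (_ : InnerProductSpace ℂ 𝓖')
        (_ : CompleteSpace 𝓖') (G : Λ → 𝓖' →L[ℂ] 𝓖), K.IsMultiplierSquare G X) ↔
      rowConj S X ≤ X := by
  rw [le_def]
  constructor
  · rintro ⟨𝓖', _, _, _, G, hG⟩
    refine isPositive_of_inner_eq (HTensor.topologicalClosure_span_range_tmul K.dense_k)
      (g := fun p : Λ × 𝓖 => (G p.1).adjoint p.2) fun p q => ?_
    rw [inner_sub_rowConj_apply X (hS _ _) (hS _ _), hG, ← mul_assoc, hβ, one_mul]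
  · intro h
    obtain ⟨Z, hZ⟩ := CStarAlgebra.nonneg_iff_eq_star_mul_self.1 ((nonneg_iff_isPositive _).2 h)
    refine ⟨K.space ⊗ₕ 𝓖, inferInstance, inferInstance, inferInstance,
      fun l => (Z ∘L HTensor.tmulL (K.k l)).adjoint, fun μ l z y => ?_⟩
    have inner_Z : ⟪Z (HTensor.tmul (K.k μ) z), Z (HTensor.tmul (K.k l) y)⟫_ℂ =
        (1 - ⟪β μ, β l⟫_ℂ) * ⟪HTensor.tmul (K.k μ) z, X (HTensor.tmul (K.k l) y)⟫_ℂ := by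
      rw [← inner_sub_rowConj_apply X (hS _ _) (hS _ _), hZ, ← adjoint_inner_right]
      rfl
    rw [adjoint_adjoint, adjoint_adjoint, comp_apply, comp_apply, HTensor.tmulL_apply,
      HTensor.tmulL_apply, inner_Z, ← mul_assoc, mul_comm (K μ l), hβ, one_mul]

theorem constProj_k {K : PosKernel Λ} {l₀ : Λ} (h : ∀ l, K l l₀ = 1) (l : Λ) :
    K.constProj (K.k l) = K.k l₀ := by
  refine Submodule.eq_starProjection_of_mem_of_inner_eq_zero (K := K.constants)
    ⟨1, fun μ => by rw [k_apply, h]⟩ ?_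
  rintro f ⟨c, hc⟩
  rw [inner_sub_left, inner_k, inner_k, hc, hc, sub_self]

theorem normalize_base {K : PosKernel Λ} (hK : K.IsPick) (l₀ l : Λ) :
    K.normalize l₀ l l₀ = 1 := by
  have norm_k_ne_zero : (‖K.k l₀‖ : ℂ) ≠ 0 :=
    Complex.ofReal_ne_zero.2 (norm_ne_zero_iff.2 (hK.k_ne_zero l₀))
  have K_base : K l₀ l₀ = (‖K.k l₀‖ : ℂ) ^ 2 :=
    (K.inner_k_k l₀ l₀).symm.trans (inner_self_eq_norm_sq_to_K _)
  have K_ne_zero := hK.ne_zero l l₀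
  simp only [normalize_apply, delta, RKHS.coe_smul, Pi.smul_apply, k_apply, smul_eq_mul, map_mul,
    map_inv₀, map_pow, Complex.conj_ofReal, K_base, Complex.ofReal_inv]
  field_simp

theorem isStarProjection_map_constProj (K : PosKernel Λ) (𝓖 : Type*) [NormedAddCommGroup 𝓖]
    [InnerProductSpace ℂ 𝓖] [CompleteSpace 𝓖] :
    IsStarProjection (HTensor.map K.constProj (ContinuousLinearMap.id ℂ 𝓖)) :=
  HTensor.isStarProjection_map (isStarProjection_starProjection (U := K.constants)) (.one _)

section Shift

variable {𝓑 𝓖 : Type*} [NormedAddCommGroup 𝓑] [InnerProductSpace ℂ 𝓑]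
  [NormedAddCommGroup 𝓖] [InnerProductSpace ℂ 𝓖] [CompleteSpace 𝓖]
  {K : PosKernel Λ} (hK : K.IsPick) {l₀ : Λ} {β : Λ → 𝓑} (hβ : K.IsPickFunction l₀ β)

theorem adjoint_shift_k (l : Λ) : (shift hK hβ).adjoint ((K.normalize l₀).k l) =
    HTensor.tmul (β l) ((K.normalize l₀).k l) := by
  rw [shift, adjoint_adjoint]
  exact (exists_adjoint_shift hK hβ).choose_spec.2 l

theorem adjoint_shiftTensor_tmul (l : Λ) (y : 𝓖) :
    (shiftTensor hK hβ 𝓖).adjoint (HTensor.tmul ((K.normalize l₀).k l) y) =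
      HTensor.tmul (β l) (HTensor.tmul ((K.normalize l₀).k l) y) := by
  set A := HTensor.assoc 𝓑 (K.normalize l₀).space 𝓖
  have adjoint_id : (ContinuousLinearMap.id ℂ 𝓖).adjoint = ContinuousLinearMap.id ℂ 𝓖 := star_one _
  refine ext_inner_right ℂ fun v => ?_
  obtain ⟨w, rfl⟩ := A.symm.surjective v
  have shiftTensor_symm : shiftTensor hK hβ 𝓖 (A.symm w) =
      HTensor.map (shift hK hβ) (ContinuousLinearMap.id ℂ 𝓖) w :=
    congrArg _ (A.apply_symm_apply w)
  rw [adjoint_inner_left, shiftTensor_symm, ← adjoint_inner_left, HTensor.adjoint_map,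
    HTensor.map_tmul, adjoint_shift_k, adjoint_id, id_apply, ← A.inner_map_map (HTensor.tmul _ _),
    A.apply_symm_apply, HTensor.assoc_tmul]

theorem shiftTensor_comp_adjoint : shiftTensor hK hβ 𝓖 ∘L (shiftTensor hK hβ 𝓖).adjoint =
    1 - HTensor.map (K.normalize l₀).constProj (ContinuousLinearMap.id ℂ 𝓖) := by
  refine ext_of_inner_eq (HTensor.topologicalClosure_span_range_tmul (K.normalize l₀).dense_k) ?_
  rintro ⟨μ, z⟩ ⟨l, y⟩
  rw [comp_apply, ← adjoint_inner_left, sub_apply, inner_sub_right, HTensor.map_tmul,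
    constProj_k (normalize_base hK l₀), adjoint_shiftTensor_tmul, adjoint_shiftTensor_tmul]
  simp only [HTensor.inner_tmul, inner_k_k, normalize_base hK, one_def, id_apply]
  linear_combination -⟪z, y⟫_ℂ * hβ.one_sub_mul_normalize hK μ l

end Shift

end PosKernel

theorem mainTheorem3 {Λ 𝓑 𝓖 : Type u}
    [NormedAddCommGroup 𝓑] [InnerProductSpace ℂ 𝓑] [CompleteSpace 𝓑]
    [NormedAddCommGroup 𝓖] [InnerProductSpace ℂ 𝓖] [CompleteSpace 𝓖]
    (K : PosKernel Λ) (hK : K.IsPick) (l₀ : Λ)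
    (β : Λ → 𝓑) (hβ : K.IsPickFunction l₀ β)
    (N : ContractiveSubspace (K.space ⊗ₕ 𝓖)) :
    -- (i)
    (∃ (𝓖' : Type u) (_ : NormedAddCommGroup 𝓖') (_ : InnerProductSpace ℂ 𝓖')
        (_ : CompleteSpace 𝓖') (G : Λ → 𝓖' →L[ℂ] 𝓖) (hG : K.IsContractiveMultiplier G),
        (PosKernel.multiplierRange hG).IsComplement N) ↔
    -- (ii)
    (∃ Bt : (N.image (HTensor.congrLeft (PosKernel.omega hK l₀) 𝓖)).Space →L[ℂ]
          𝓑 ⊗ₕ (N.image (HTensor.congrLeft (PosKernel.omega hK l₀) 𝓖)).Space,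
        ‖Bt‖ ≤ 1 ∧
        ∀ ξ : N.Space,
          let ΩN := N.image (HTensor.congrLeft (PosKernel.omega hK l₀) 𝓖)
          let Ωξ : ΩN.Space := N.toImage (HTensor.congrLeft (PosKernel.omega hK l₀) 𝓖) ξ
          let π' : (K.normalize l₀).space ⊗ₕ 𝓖 →L[ℂ] (K.normalize l₀).space ⊗ₕ 𝓖 :=
            HTensor.map (K.normalize l₀).constProj (ContinuousLinearMap.id ℂ 𝓖)
          ΩN.incl Ωξ =
              PosKernel.shiftTensor hK hβ 𝓖
                (HTensor.map (ContinuousLinearMap.id ℂ 𝓑) ΩN.incl (Bt Ωξ)) +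
              π' (ΩN.incl Ωξ) ∧
          ‖Bt Ωξ‖ ^ 2 ≤ ‖Ωξ‖ ^ 2 - ‖π' (ΩN.incl Ωξ)‖ ^ 2) := by
  let ΩN := N.image (HTensor.congrLeft (PosKernel.omega hK l₀) 𝓖)
  have isComplement_iff_normalize {𝓖' : Type u} [NormedAddCommGroup 𝓖'] [InnerProductSpace ℂ 𝓖']
      [CompleteSpace 𝓖'] (G : Λ → 𝓖' →L[ℂ] 𝓖) :
      (∃ hG : K.IsContractiveMultiplier G, (PosKernel.multiplierRange hG).IsComplement N) ↔
        (K.normalize l₀).IsMultiplierSquare G ΩN.defect :=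
    PosKernel.exists_isComplement_iff.trans
      (PosKernel.isMultiplierSquare_normalize_iff hK (N.defect_image_apply _)).symm
  simp only [isComplement_iff_normalize]
  rw [PosKernel.exists_isMultiplierSquare_iff_rowConj_le (hβ.one_sub_mul_normalize hK)
    (PosKernel.adjoint_shiftTensor_tmul hK hβ), ContractiveSubspace.defect,
    rowConj_one_sub_comp_adjoint_le_iff ((K.normalize l₀).isStarProjection_map_constProj 𝓖)
      (PosKernel.shiftTensor_comp_adjoint hK hβ)]
  exact exists_congr fun Bt => and_congr_right fun _ => (N.toImage _).surjective.forall
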